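/- Let $\mathcal H$ be a separable real Hilbert space, $\mathcal Y$ a real Banach space, $\mathcal K\subset\mathcal Y$ a nonempty closed convex cone with positive dual cone $\mathcal K^+=\{v^*\in\mathcal Y^*:\langle v^*,y\rangle\ge 0\ \forall y\in\mathcal K\}$, and $\mathcal C\subset\mathcal Y^*$ a nonempty weak$^*$-compact convex set with $\operatorname{cl}^{w^*}\operatorname{cone}\mathcal C=\mathcal K^+$. Let $\xi$ be an $m$-dimensional random vector on a probability space $(\Omega,\mathcal F,\mathbb P)$ having a density with respect to Lebesgue measure, let $\Phi:\mathcal H\times\mathbb R^m\to\mathcal Y$ be continuous, and let $h:\mathcal H\to\mathbb R$ be a continuously differentiable convex function such that for every $v^*\in\mathcal C$ the function $(x,z)\mapsto\langle v^*,\Phi(x,z)\rangle+h(x)$ is convex on $\mathcal H\times\mathbb R^m$. For $f:E\to\mathbb R\cup\{+\infty\}$ on a Hilbert space $E$ and $\lambda>0$ write $e_\lambda f(x)=\inf_{z\in E}\big(f(z)+\tfrac1{2\lambda}\|x-z\|^2\big)$ for the Moreau envelope. Put $S(x,z)=\sup_{v^*\in\mathcal C}\big(\langle v^*,\Phi(x,z)\rangle+h(x)\big)$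 on the Hilbert space $\mathcal H\times\mathbb R^m$, and $$\varphi(x)=\mathbb P\big(\Phi(x,\xi)\in-\mathcal K\big),\qquad \varphi_\lambda(x)=\mathbb P\big(e_\lambda S(x,\xi)\le h(x)\big).$$ Fix $p\in[0,1]$ and set $M(p)=\{x:\varphi(x)\ge p\}$, $M_\lambda(p)=\{x:\varphi_\lambda(x)\ge p\}$. Let $\psi:\mathcal H\to\mathbb R\cup\{+\infty\}$ be convex, lower semicontinuous and coercive (all sets $\{\psi\le\alpha\}$, $\alpha\in\mathbb R$, are bounded), with $M(p)\cap\operatorname{dom}\psi\neq\emptyset$. Let $(P)$ be the problem of minimizing $\psi$ over $M(p)$ and $(P_\lambda)$ that of minimizing $e_\lambda\psi$ over $M_\lambda(p)$, with values (infima) $v(P)$ and $v(P_\lambda)$. Then: a) $v(P)\in\mathbb R$ and $v(P_\lambda)\in\mathbb R$ for all $\lambda>0$; and, provided that $h$ is sequentially weakly continuous, $v(P_\lambda)\to v(P)$ as $\lambda\to0^+$. b) Suppose that $h$ is sequentially weakly continuous. Let $\lambda_k\to0^+$ and let $x_k$ be an optimal solution of $(P_{\lambda_k})$ for each $k$. If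 $x_k\rightharpoonup x_0$ weakly, then $x_0$ is an optimal solution of $(P)$. If, furthermore, $\operatorname{dom}\psi=\mathcal H$ and the conjugate $\psi^*(u)=\sup_y(\langle u,y\rangle-\psi(y))$ is Fréchet differentiable at every $u$ with $\partial\psi^*(u)\ne\emptyset$, then $x_k\to x_0$ in norm. -/

import Mathlib

open Set Filter Topology MeasureTheory
open scoped InnerProductSpace

noncomputable section

namespace ChanceConstraint

/-! ### Extended-real-valued convex analysis -/

section ConvexAnalysis

variable {E : Type*}

/-- The effective domain of an extended-real-valued function. -/
def effDom (f : E → EReal) : Set E := {x | f x < ⊤}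

/-- Convexity of an extended-real-valued function: its epigraph is a convex set. -/
def IsConvexFun [AddCommGroup E] [Module ℝ E] (f : E → EReal) : Prop :=
  Convex ℝ {q : E × ℝ | f q.1 ≤ (q.2 : EReal)}

/-- Coercivity: all (real) sublevel sets are bounded. -/
def IsCoercive [Bornology E] (f : E → EReal) : Prop :=
  ∀ α : ℝ, Bornology.IsBounded {x | f x ≤ (α : EReal)}

/-- The Moreau envelope of `f` of parameter `lam`. -/
def moreauEnv [NormedAddCommGroup E] (f : E → EReal) (lam : ℝ) (x : E) : EReal :=
  ⨅ z : E, f z + ((1 / (2 * lam) * ‖x - z‖ ^ 2 : ℝ) : EReal)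

variable [NormedAddCommGroup E] [InnerProductSpace ℝ E]

/-- The Legendre-Fenchel conjugate. -/
def conjugate (f : E → EReal) (z : E) : EReal :=
  ⨆ y : E, ((⟪z, y⟫_ℝ : ℝ) : EReal) - f y

/-- The convex subdifferential (empty where `f = +∞`). -/
def subdiff (f : E → EReal) (x : E) : Set E :=
  {z | f x < ⊤ ∧ ∀ y : E, f x + ((⟪z, y - x⟫_ℝ : ℝ) : EReal) ≤ f y}

/-- Fréchet differentiability of an extended-real-valued function at `x`: it is finite near `x`
and the resulting real-valued function is differentiable at `x`. -/
def FrechetDiffAt (f : E → EReal) (x : E) : Prop :=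
  (∀ᶠ y in 𝓝 x, f y ≠ ⊤ ∧ f y ≠ ⊥) ∧ DifferentiableAt ℝ (fun y => (f y).toReal) x

/-- Weak convergence of a sequence in a Hilbert space. -/
def WeaklyTendsto (u : ℕ → E) (x : E) : Prop :=
  ∀ y : E, Tendsto (fun k => ⟪y, u k⟫_ℝ) atTop (𝓝 ⟪y, x⟫_ℝ)

/-- Sequential weak continuity of a real function on a Hilbert space. -/
def SeqWeaklyContinuous (h : E → ℝ) : Prop :=
  ∀ (u : ℕ → E) (x : E), WeaklyTendsto u x → Tendsto (fun k => h (u k)) atTop (𝓝 (h x))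

end ConvexAnalysis

/-! ### Cones in the dual of a Banach space -/

section Cones

variable {Y : Type*} [NormedAddCommGroup Y] [NormedSpace ℝ Y]

/-- The positive dual cone of `K`, in the topological dual with its weak-* topology. -/
def posDual (K : Set Y) : Set (WeakDual ℝ Y) := {v | ∀ y ∈ K, 0 ≤ v y}

/-- The cone generated by a convex set `C`. -/
def genCone (C : Set (WeakDual ℝ Y)) : Set (WeakDual ℝ Y) :=
  {w | ∃ t : ℝ, 0 ≤ t ∧ ∃ v ∈ C, w = t • v}

end Cones

/-! ### The probability functions and the optimization problems -/

section Problem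

variable {H Y Ω : Type*} [NormedAddCommGroup H] [InnerProductSpace ℝ H]
  [NormedAddCommGroup Y] [NormedSpace ℝ Y] [MeasurableSpace Ω] {m : ℕ}

/-- The supremum function `S(x, z) = sup {⟨v, Φ(x, z)⟩ + h(x) : v ∈ C}` on the Hilbert space
`H × ℝᵐ` (the product with its Hilbert norm). -/
def supFun (Φ : H × EuclideanSpace ℝ (Fin m) → Y) (h : H → ℝ) (C : Set (WeakDual ℝ Y))
    (q : WithLp 2 (H × EuclideanSpace ℝ (Fin m))) : EReal :=
  ⨆ v ∈ C, ((v (Φ (q.fst, q.snd)) + h q.fst : ℝ) : EReal)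

/-- The probability function `φ(x) = ℙ(Φ(x, ξ) ∈ -K)`. -/
def probFun (P : Measure Ω) (ξ : Ω → EuclideanSpace ℝ (Fin m))
    (Φ : H × EuclideanSpace ℝ (Fin m) → Y) (K : Set Y) (x : H) : ℝ :=
  P.real {ω | -Φ (x, ξ ω) ∈ K}

/-- The inner regularization of the probability function: `S` is replaced by its Moreau envelope
in `φ(x) = ℙ(S(x, ξ) ≤ h(x))`. -/
def probFunReg (P : Measure Ω) (ξ : Ω → EuclideanSpace ℝ (Fin m))
    (Φ : H × EuclideanSpace ℝ (Fin m) → Y) (h : H → ℝ) (C : Set (WeakDual ℝ Y))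
    (lam : ℝ) (x : H) : ℝ :=
  P.real {ω | moreauEnv (supFun Φ h C) lam (WithLp.toLp 2 (x, ξ ω)) ≤ (h x : EReal)}

/-- The feasible set `M(p)`. -/
def feas (P : Measure Ω) (ξ : Ω → EuclideanSpace ℝ (Fin m))
    (Φ : H × EuclideanSpace ℝ (Fin m) → Y) (K : Set Y) (p : ℝ) : Set H :=
  {x | p ≤ probFun P ξ Φ K x}

/-- The regularized feasible set `M_λ(p)`. -/
def feasReg (P : Measure Ω) (ξ : Ω → EuclideanSpace ℝ (Fin m))
    (Φ : H × EuclideanSpace ℝ (Fin m) → Y) (h : H → ℝ) (C : Set (WeakDual ℝ Y))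
    (p lam : ℝ) : Set H :=
  {x | p ≤ probFunReg P ξ Φ h C lam x}

/-- The value of the problem of minimizing `f` over `M`. -/
def value (f : H → EReal) (M : Set H) : EReal := ⨅ x ∈ M, f x

/-- `x` is an optimal solution of the problem of minimizing `f` over `M`. -/
def IsOptimal (f : H → EReal) (M : Set H) (x : H) : Prop := x ∈ M ∧ IsMinOn f M x

end Problem

end ChanceConstraint

end

/-! Since `C` generates the positive dual cone, Hahn–Banach separation turns `-Φ(x, z) ∈ K` into
`S(x, z) ≤ h(x)`. Moreau envelopes lie below their functions, so the regularized problem has a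
larger feasible set and a smaller objective, whence `v(P_λ) ≤ v(P)`. Finiteness holds because a
coercive convex lower semicontinuous `ψ` is bounded below.

The converse is weak compactness. A convex lower semicontinuous function has a minorant `a - b‖·‖`,
so an envelope bounded above along `λ → 0` forces near-minimizers towards the base points, and weak
lower semicontinuity bounds the function at the weak limit
(`IsConvexFun.exists_seq_of_moreauEnv_le`). Applied to `S` at each outcome in the limsup of the
events, this makes weak limits feasible (`mem_feas_of_weaklyTendsto`); applied to `ψ`, it makes them
optimal.

For norm convergence, take a subgradient `u` of `ψ` at `x₀`: the near-minimizers minimize `ψ - ⟨u,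
·⟩` asymptotically, and Fréchet differentiability of the conjugate at `u` makes that minimum strong.
-/

namespace ChanceConstraint

/-! ### Weak sequential convergence in Hilbert space. -/

section WeakConvergence

variable {E : Type*} [NormedAddCommGroup E] [InnerProductSpace ℝ E]

/-- Bounded sequences in a separable Hilbert space have weakly convergent subsequences. -/
theorem exists_subseq_weaklyTendsto [CompleteSpace E] [TopologicalSpace.SeparableSpace E]
    {u : ℕ → E} {R : ℝ} (hu : ∀ k, ‖u k‖ ≤ R) :
    ∃ (x : E) (φ : ℕ → ℕ), StrictMono φ ∧ WeaklyTendsto (u ∘ φ) x := by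
  -- The Riesz isomorphism carries the sequence into the dual, where separability makes closed balls
  -- weak-* sequentially compact.
  have hs := WeakDual.isSeqCompact_closedBall ℝ E (0 : StrongDual ℝ E) R
  obtain ⟨a, -, φ, hφ, ha⟩ := hs (x := fun k =>
    StrongDual.toWeakDual (InnerProductSpace.toDual ℝ E (u k))) (fun k => by
      simpa using hu k)
  refine ⟨(InnerProductSpace.toDual ℝ E).symm (WeakDual.toStrongDual a), φ, hφ, fun y => ?_⟩
  have h1 := (WeakDual.eval_continuous y).continuousAt.tendsto.comp ha
  rw [real_inner_comm, InnerProductSpace.toDual_symm_apply]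
  refine h1.congr fun k => ?_
  change ⟪u (φ k), y⟫_ℝ = _
  rw [real_inner_comm]
  rfl

theorem WeaklyTendsto.comp_tendsto {u : ℕ → E} {x : E} (h : WeaklyTendsto u x) {φ : ℕ → ℕ}
    (hφ : Tendsto φ atTop atTop) : WeaklyTendsto (fun k => u (φ k)) x :=
  fun y => (h y).comp hφ

/-- Weak limits are unaffected by a perturbation converging to zero in norm. -/
theorem WeaklyTendsto.of_norm_sub_tendsto_zero {u w : ℕ → E} {x : E} (h : WeaklyTendsto u x)
    (hw : Tendsto (fun k => ‖u k - w k‖) atTop (𝓝 0)) : WeaklyTendsto w x := by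
  intro y
  have h1 : Tendsto (fun k => ⟪y, u k - w k⟫_ℝ) atTop (𝓝 0) := by
    have h2 := (tendsto_const_nhds (x := y)).inner (𝕜 := ℝ)
      (tendsto_zero_iff_norm_tendsto_zero.2 hw)
    simpa using h2
  simpa [inner_sub_right] using (h y).sub h1

/-- Weakly convergent sequences are bounded. -/
theorem WeaklyTendsto.exists_norm_le [CompleteSpace E] {u : ℕ → E} {x : E}
    (h : WeaklyTendsto u x) : ∃ R, ∀ k, ‖u k‖ ≤ R := by
  obtain ⟨R, hR⟩ := banach_steinhaus (g := fun k => innerSL ℝ (u k)) fun y => by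
    obtain ⟨c, hc⟩ := ((h y).norm).bddAbove_range
    refine ⟨c, fun k => ?_⟩
    simpa [real_inner_comm] using hc ⟨k, rfl⟩
  exact ⟨R, fun k => by simpa using hR k⟩

/-- Closed convex sets are weakly sequentially closed. -/
theorem WeaklyTendsto.mem_of_isClosed_of_convex [CompleteSpace E] {u : ℕ → E} {x : E}
    (h : WeaklyTendsto u x) {s : Set E} (hs : IsClosed s) (hc : Convex ℝ s)
    (hu : ∀ᶠ k in atTop, u k ∈ s) : x ∈ s := by
  by_contra hx
  obtain ⟨f, c, hf, hcx⟩ := geometric_hahn_banach_closed_point hc hs hx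
  have h1 := h ((InnerProductSpace.toDual ℝ E).symm f)
  simp only [InnerProductSpace.toDual_symm_apply] at h1
  exact hcx.not_ge (le_of_tendsto h1 (hu.mono fun k hk => (hf _ hk).le))

end WeakConvergence

/-! ### Moreau envelopes and lower bounds for convex functions. -/

section ConvexFunctions

/-- A quadratic penalty with exploding weight beats linear growth. Here `t` will be the distance
from a base point to a near-minimizer of the envelope. -/
theorem tendsto_zero_of_sq_div_le {t lam : ℕ → ℝ} {A B : ℝ} (ht : ∀ k, 0 ≤ t k)
    (hlam : ∀ k, 0 < lam k) (hlim : Tendsto lam atTop (𝓝 0))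
    (h : ∀ k, 1 / (2 * lam k) * t k ^ 2 ≤ A + B * t k) : Tendsto t atTop (𝓝 0) := by
  have hsq : Tendsto (fun k => t k ^ 2) atTop (𝓝 0) := by
    have hub : Tendsto (fun k => 4 * lam k * A + 4 * lam k ^ 2 * B ^ 2) atTop (𝓝 0) := by
      simpa using ((hlim.const_mul 4).mul_const A).add (((hlim.pow 2).const_mul 4).mul_const (B ^ 2))
    refine squeeze_zero (fun k => sq_nonneg _) (fun k => ?_) hub
    have h1 := mul_le_mul_of_nonneg_left (h k) (mul_pos two_pos (hlam k)).le
    have h2 : 2 * lam k * (1 / (2 * lam k) * t k ^ 2) = t k ^ 2 := by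
      have := hlam k
      field_simp
    rw [h2] at h1
    -- Young's inequality `4λBt ≤ t² + 4λ²B²` absorbs the linear term.
    nlinarith [sq_nonneg (t k - 2 * lam k * B)]
  have := hsq.sqrt
  simpa [Real.sqrt_sq (ht _)] using this

variable {E : Type*}

theorem IsConvexFun.convex_sublevel [AddCommGroup E] [Module ℝ E] {f : E → EReal}
    (hf : IsConvexFun f) (α : ℝ) : Convex ℝ {x | f x ≤ (α : EReal)} := by
  intro x hx y hy a b ha hb hab
  have h := hf (x := (x, α)) hx (y := (y, α)) hy ha hb hab
  have h2 : a * α + b * α = α := by rw [← add_mul, hab, one_mul]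
  simpa [h2] using h

variable [NormedAddCommGroup E]

theorem moreauEnv_le (f : E → EReal) (lam : ℝ) (x : E) : moreauEnv f lam x ≤ f x := by
  refine (iInf_le _ x).trans ?_
  simp

theorem le_moreauEnv {f : E → EReal} {c : EReal} (hf : ∀ x, c ≤ f x) {lam : ℝ} (hl : 0 < lam)
    (x : E) : c ≤ moreauEnv f lam x := by
  refine le_iInf fun z => (hf z).trans ?_
  refine le_add_of_nonneg_right ?_
  exact_mod_cast (by positivity : (0 : ℝ) ≤ 1 / (2 * lam) * ‖x - z‖ ^ 2)

/-- A real number above the Moreau envelope is attained by a competitor. -/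
theorem exists_of_moreauEnv_lt {f : E → EReal} (hbot : ∀ x, f x ≠ ⊥) {lam : ℝ} {x : E} {c : ℝ}
    (h : moreauEnv f lam x < c) :
    ∃ (z : E) (r : ℝ), f z = r ∧ r + 1 / (2 * lam) * ‖x - z‖ ^ 2 < c := by
  obtain ⟨z, hz⟩ := iInf_lt_iff.1 h
  have htop : f z ≠ ⊤ := by
    intro ht
    rw [ht, EReal.top_add_coe] at hz
    exact not_top_lt hz
  refine ⟨z, (f z).toReal, (EReal.coe_toReal htop (hbot z)).symm, ?_⟩
  rw [← EReal.coe_toReal htop (hbot z)] at hz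
  exact_mod_cast hz

/-- Near-minimizers in the definition of the Moreau envelope approach the base points as the
parameter tends to zero, if the envelopes stay bounded above. -/
theorem exists_seq_of_moreauEnv_lt {f : E → EReal} (hbot : ∀ x, f x ≠ ⊥) {a b : ℝ} (hb : 0 ≤ b)
    (hab : ∀ w, ((a - b * ‖w‖ : ℝ) : EReal) ≤ f w) {lam c : ℕ → ℝ} {q : ℕ → E} {R M : ℝ}
    (hlam : ∀ k, 0 < lam k) (hlim : Tendsto lam atTop (𝓝 0)) (hq : ∀ k, b * ‖q k‖ ≤ R)
    (hcM : ∀ k, c k ≤ M) (hc : ∀ k, moreauEnv f (lam k) (q k) < c k) :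
    ∃ w : ℕ → E, (∀ k, f (w k) ≤ c k) ∧ Tendsto (fun k => ‖q k - w k‖) atTop (𝓝 0) := by
  choose w r hr hw using fun k => exists_of_moreauEnv_lt hbot (hc k)
  refine ⟨w, fun k => ?_, ?_⟩
  · rw [hr, EReal.coe_le_coe_iff]
    have : 0 ≤ 1 / (2 * lam k) * ‖q k - w k‖ ^ 2 := by
      have := hlam k
      positivity
    linarith [hw k]
  · refine tendsto_zero_of_sq_div_le (A := M - a + R) (B := b) (fun k => norm_nonneg _) hlam hlim
      fun k => ?_
    have h1 := hab (w k)
    rw [hr, EReal.coe_le_coe_iff] at h1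
    have h2 : b * ‖w k‖ ≤ b * (‖q k‖ + ‖q k - w k‖) := by
      gcongr
      have := norm_sub_norm_le (w k) (q k)
      rw [norm_sub_rev] at this
      linarith
    linarith [hw k, hcM k, hq k]

variable [NormedSpace ℝ E]

/-- A convex lower semicontinuous function that never takes the value `-∞` decreases at most
linearly in the norm. -/
theorem IsConvexFun.exists_minorant {f : E → EReal} (hf : IsConvexFun f)
    (hlsc : LowerSemicontinuous f) (hbot : ∀ x, f x ≠ ⊥) :
    ∃ a b : ℝ, 0 ≤ b ∧ ∀ w, ((a - b * ‖w‖ : ℝ) : EReal) ≤ f w := by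
  by_cases hdom : ∃ x₀, f x₀ ≠ ⊤
  swap
  · push Not at hdom
    exact ⟨0, 0, le_rfl, fun w => by simp [hdom w]⟩
  obtain ⟨x₀, hx₀⟩ := hdom
  obtain ⟨c, hc⟩ : ∃ c : ℝ, f x₀ = c := ⟨_, (EReal.coe_toReal hx₀ (hbot x₀)).symm⟩
  have h1 : ∀ᶠ y in 𝓝 x₀, ((c - 1 : ℝ) : EReal) < f y :=
    hlsc x₀ _ (show _ < f x₀ by rw [hc]; exact_mod_cast sub_one_lt c)
  obtain ⟨r, hr, hball⟩ := Metric.nhds_basis_closedBall.eventually_iff.1 h1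
  -- On the ball of radius `r`, `f` drops by less than 1 from `c`; convexity then limits the descent
  -- outside to slope `1 / r`. The term `‖x₀‖ / r` recentres the bound at the origin.
  refine ⟨c - 1 - ‖x₀‖ / r, 1 / r, by positivity, fun w => ?_⟩
  have key : ((c - 1 - ‖w - x₀‖ / r : ℝ) : EReal) ≤ f w := by
    rcases le_or_gt ‖w - x₀‖ r with hw | hw
    · refine le_trans ?_ (hball (x := w) (by simpa [dist_eq_norm] using hw)).le
      exact_mod_cast sub_le_self _ (by positivity)
    by_contra hcon
    push Not at hcon
    have hwtop : f w ≠ ⊤ := (hcon.trans (EReal.coe_lt_top _)).ne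
    obtain ⟨d, hd⟩ : ∃ d : ℝ, f w = d := ⟨_, (EReal.coe_toReal hwtop (hbot w)).symm⟩
    rw [hd, EReal.coe_lt_coe_iff] at hcon
    set n := ‖w - x₀‖ with hn
    have hn0 : 0 < n := hr.trans hw
    have ht1 : r / n ≤ 1 := (div_le_one hn0).2 hw.le
    -- This convex combination lies on the sphere of radius `r` about `x₀`; too small a value at `w`
    -- would push `f` below `c - 1` there.
    have hep := hf (x := (x₀, c)) (by simp [hc]) (y := (w, d)) (by simp [hd])
      (a := 1 - r / n) (b := r / n) (by linarith) (by positivity) (by ring)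
    simp only [Prod.smul_mk, Prod.mk_add_mk, mem_ofPred_eq, smul_eq_mul] at hep
    have hmem : (1 - r / n) • x₀ + (r / n) • w ∈ Metric.closedBall x₀ r := by
      have : (1 - r / n) • x₀ + (r / n) • w - x₀ = (r / n) • (w - x₀) := by module
      rw [Metric.mem_closedBall, dist_eq_norm, this, norm_smul, Real.norm_of_nonneg (by positivity),
        ← hn, div_mul_cancel₀ _ hn0.ne']
    have h2 := (hball hmem).trans_le hep
    rw [EReal.coe_lt_coe_iff] at h2
    have h3 : (r / n) * (d - c) < (r / n) * (- 1 - n / r) :=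
      mul_lt_mul_of_pos_left (by linarith) (by positivity)
    have h4 : (r / n) * (n / r) = 1 := by field_simp
    have h5 : 0 < r / n := by positivity
    nlinarith
  refine le_trans ?_ key
  rw [EReal.coe_le_coe_iff]
  have h2 : ‖w - x₀‖ / r ≤ (‖w‖ + ‖x₀‖) / r := by gcongr; exact norm_sub_le _ _
  rw [add_div] at h2
  have : 1 / r * ‖w‖ = ‖w‖ / r := by ring
  linarith

/-- A coercive convex lower semicontinuous function that never takes the value `-∞` is bounded
below. -/
theorem IsConvexFun.exists_forall_le {f : E → EReal} (hf : IsConvexFun f)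
    (hlsc : LowerSemicontinuous f) (hbot : ∀ x, f x ≠ ⊥) (hcoer : IsCoercive f) :
    ∃ c : ℝ, ∀ x, (c : EReal) ≤ f x := by
  obtain ⟨a, b, hb, hab⟩ := hf.exists_minorant hlsc hbot
  obtain ⟨R, hR⟩ := (hcoer 0).exists_norm_le
  -- The level 0 is arbitrary: above it there is nothing to prove, and the sublevel set lies in a
  -- ball of radius `R`, where the minorant is at least `a - b * R`.
  refine ⟨min 0 (a - b * R), fun x => ?_⟩
  rcases le_or_gt (f x) ((0 : ℝ) : EReal) with hx | hx
  · refine le_trans ?_ (hab x)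
    rw [EReal.coe_le_coe_iff]
    have := mul_le_mul_of_nonneg_left (hR x hx) hb
    exact (min_le_right _ _).trans (by linarith)
  · exact le_trans (by exact_mod_cast min_le_left _ _) hx.le

end ConvexFunctions

/-! ### Weak lower semicontinuity, subgradients and differentiability of the conjugate. -/

section HilbertConvexFunctions

variable {E : Type*} [NormedAddCommGroup E] [InnerProductSpace ℝ E] [CompleteSpace E]

/-- Convex lower semicontinuous functions are weakly sequentially lower semicontinuous. -/
theorem WeaklyTendsto.le_of_forall_le {f : E → EReal} (hf : IsConvexFun f)
    (hlsc : LowerSemicontinuous f) {u : ℕ → E} {x : E} (hu : WeaklyTendsto u x) {c : ℕ → ℝ}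
    {c₀ : ℝ} (hc : Tendsto c atTop (𝓝 c₀)) (h : ∀ k, f (u k) ≤ c k) : f x ≤ c₀ := by
  refine EReal.le_of_forall_lt_iff_le.1 fun d hd => ?_
  refine hu.mem_of_isClosed_of_convex (s := {y | f y ≤ (d : EReal)})
    (hlsc.isClosed_preimage _) (hf.convex_sublevel d) ?_
  filter_upwards [hc.eventually_lt_const (EReal.coe_lt_coe_iff.1 hd)] with k hk
  exact (h k).trans (by exact_mod_cast hk.le)

/-- Along weakly convergent base points and vanishing parameters, the Moreau envelopes satisfy
the lower epi-limit inequality, realized by near-minimizers. -/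
theorem IsConvexFun.exists_seq_of_moreauEnv_le {f : E → EReal} (hf : IsConvexFun f)
    (hlsc : LowerSemicontinuous f) (hbot : ∀ x, f x ≠ ⊥) {lam c : ℕ → ℝ} {q : ℕ → E} {q₀ : E}
    {c₀ : ℝ} (hlam : ∀ k, 0 < lam k) (hlim : Tendsto lam atTop (𝓝 0)) (hq : WeaklyTendsto q q₀)
    (hc : Tendsto c atTop (𝓝 c₀)) (h : ∀ k, moreauEnv f (lam k) (q k) ≤ c k) :
    ∃ (w : ℕ → E) (d : ℕ → ℝ), (∀ k, f (w k) ≤ d k) ∧ Tendsto d atTop (𝓝 c₀) ∧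
      Tendsto (fun k => ‖q k - w k‖) atTop (𝓝 0) ∧ WeaklyTendsto w q₀ ∧ f q₀ ≤ c₀ := by
  obtain ⟨a, b, hb, hab⟩ := hf.exists_minorant hlsc hbot
  obtain ⟨R, hR⟩ := hq.exists_norm_le
  -- The slack `1 / (k + 1)` makes the bound strict, so that a competitor below it exists even if
  -- the infimum is not attained.
  have hd : Tendsto (fun k : ℕ => c k + 1 / ((k : ℝ) + 1)) atTop (𝓝 c₀) := by
    simpa using hc.add tendsto_one_div_add_atTop_nhds_zero_nat
  obtain ⟨M, hM⟩ := hd.bddAbove_range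
  obtain ⟨w, hw, hqw⟩ := exists_seq_of_moreauEnv_lt hbot hb hab (R := b * R) hlam hlim
    (fun k => mul_le_mul_of_nonneg_left (hR k) hb) (fun k => hM ⟨k, rfl⟩)
    (fun k => (h k).trans_lt (by
      rw [EReal.coe_lt_coe_iff]
      have : 0 < 1 / ((k : ℝ) + 1) := by positivity
      linarith))
  have hww := hq.of_norm_sub_tendsto_zero hqw
  exact ⟨w, _, hw, hd, hqw, hww, hww.le_of_forall_le hf hlsc hd hw⟩

/-- A convex lower semicontinuous real function on a Hilbert space has subgradients everywhere. -/
theorem _root_.ConvexOn.exists_subgradient {g : E → ℝ} (hg : ConvexOn ℝ univ g)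
    (hlsc : LowerSemicontinuous g) (x₀ : E) : ∃ u : E, ∀ y, g x₀ + ⟪u, y - x₀⟫_ℝ ≤ g y := by
  -- Baire: closed sublevel sets at integer levels cover the space, so one has interior; a convex
  -- function bounded above near one point is continuous.
  have hcont : Continuous g := by
    obtain ⟨n, y, hy⟩ : ∃ n : ℕ, (interior (g ⁻¹' Iic (n : ℝ))).Nonempty := by
      refine nonempty_interior_of_iUnion_of_closed (fun n => hlsc.isClosed_preimage _) ?_
      refine eq_univ_of_forall fun x => ?_
      obtain ⟨n, hn⟩ := exists_nat_ge (g x)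
      exact mem_iUnion.2 ⟨n, hn⟩
    have h4 : ∃ x₀ ∈ (univ : Set E), (𝓝 x₀).IsBoundedUnder (· ≤ ·) g :=
      ⟨y, mem_univ _, n, by
        rw [eventually_map]
        exact mem_of_superset (isOpen_interior.mem_nhds hy) interior_subset⟩
    exact continuousOn_univ.1 (((hg.continuousOn_tfae isOpen_univ univ_nonempty).out 3 1).1 h4)
  have hopen : IsOpen {p : E × ℝ | p.1 ∈ univ ∧ g p.1 < p.2} := by
    simpa using isOpen_lt (hcont.comp continuous_fst) continuous_snd
  obtain ⟨F, hF⟩ := geometric_hahn_banach_open_point (x := (x₀, g x₀)) hg.convex_strict_epigraph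
    hopen (by simp)
  set c := F (0, 1) with hc
  set F₁ : StrongDual ℝ E := F.comp (ContinuousLinearMap.inl ℝ E ℝ) with hF₁
  have hFd : ∀ y t, F (y, t) = F₁ y + t * c := by
    intro y t
    have : (y, t) = ((y, 0) : E × ℝ) + t • ((0, 1) : E × ℝ) := by simp
    rw [this, map_add, map_smul, smul_eq_mul]
    rfl
  -- The separating hyperplane is not vertical, since the point directly above `(x₀, g x₀)` is
  -- strictly separated from it.
  have hc0 : c < 0 := by
    have := hF (x₀, g x₀ + 1) (by simp)
    rw [hFd, hFd] at this
    linarith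
  refine ⟨(InnerProductSpace.toDual ℝ E).symm ((-c)⁻¹ • F₁), fun y => ?_⟩
  rw [InnerProductSpace.toDual_symm_apply]
  refine le_of_forall_pos_le_add fun ε hε => ?_
  have h1 := hF (y, g y + ε) (by simpa using hε)
  rw [hFd, hFd] at h1
  have h2 : F₁ (y - x₀) ≤ -c * (g y + ε - g x₀) := by
    rw [map_sub]
    linarith
  have h3 : (-c)⁻¹ * F₁ (y - x₀) ≤ g y + ε - g x₀ := by
    rwa [inv_mul_le_iff₀ (by linarith)]
  rw [smul_apply, smul_eq_mul]
  linarith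

/-- If the conjugate of `f` is Fréchet differentiable at `u`, then minimizing sequences of
`f - ⟨u, ·⟩` converge in norm to the gradient. -/
theorem exists_gradient_of_frechetDiffAt_conjugate {f : E → EReal} {u : E}
    (hdiff : FrechetDiffAt (conjugate f) u) : ∃ D : E, ∀ (y : ℕ → E) (ε : ℕ → ℝ),
      Tendsto ε atTop (𝓝 0) → (∀ k, f (y k) ≤
        ((⟪u, y k⟫_ℝ - (conjugate f u).toReal + ε k : ℝ) : EReal)) →
      Tendsto y atTop (𝓝 D) := by
  obtain ⟨hfin, hd⟩ := hdiff
  set G : E → ℝ := fun y => (conjugate f y).toReal with hG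
  obtain ⟨G', hG'⟩ := hd
  set D := (InnerProductSpace.toDual ℝ E).symm G' with hD
  have hGD : ∀ v, G' v = ⟪D, v⟫_ℝ := fun v => by rw [hD, InnerProductSpace.toDual_symm_apply]
  refine ⟨D, fun y ε hε hy => ?_⟩
  rw [Metric.tendsto_atTop]
  intro η hη
  have h1 := hG'.isLittleO.def (c := η / 2) (by positivity)
  obtain ⟨δ, hδ, hball⟩ := Metric.nhds_basis_closedBall.eventually_iff.1 (h1.and hfin)
  obtain ⟨N, hN⟩ := eventually_atTop.1 (hε.eventually_lt_const (show 0 < δ * (η / 2) by positivity))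
  refine ⟨N, fun k hk => ?_⟩
  rw [dist_eq_norm]
  by_contra hcon
  push Not at hcon
  set s := ‖y k - D‖ with hs
  have hs0 : 0 < s := hη.trans_le hcon
  -- Testing the conjugate at `u + v`, with `v` of length `δ` along the error, yields `δ * s ≤ δ *
  -- (η / 2) + ε k < δ * η`, against `η ≤ s`.
  set v := (δ / s) • (y k - D) with hv
  have hvn : ‖v‖ = δ := by
    rw [hv, norm_smul, Real.norm_of_nonneg (by positivity), ← hs, div_mul_cancel₀ _ hs0.ne']
  obtain ⟨hb1, hb2, hb3⟩ := hball (x := u + v) (by simp [hvn])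
  have h2 : ((⟪u + v, y k⟫_ℝ : ℝ) : EReal) - f (y k) ≤ ((G (u + v) : ℝ) : EReal) := by
    rw [hG, EReal.coe_toReal hb2 hb3]
    exact le_iSup (fun z : E => ((⟪u + v, z⟫_ℝ : ℝ) : EReal) - f z) (y k)
  have h3 : ⟪u + v, y k⟫_ℝ - (⟪u, y k⟫_ℝ - G u + ε k) ≤ G (u + v) := by
    rw [← EReal.coe_le_coe_iff, EReal.coe_sub]
    exact (EReal.sub_le_sub le_rfl (hy k)).trans h2
  have h4 : G (u + v) - G u - ⟪D, v⟫_ℝ ≤ η / 2 * δ := by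
    have := (le_abs_self _).trans hb1
    simpa [hvn, hGD] using this
  have h5 : ⟪v, y k - D⟫_ℝ = δ * s := by
    rw [hv, real_inner_smul_left, real_inner_self_eq_norm_sq, ← hs]
    field_simp
  rw [inner_add_left] at h3
  rw [inner_sub_right] at h5
  have h6 := hN k hk
  have h7 := mul_le_mul_of_nonneg_left hcon hδ.le
  have h8 := real_inner_comm D v
  linarith

end HilbertConvexFunctions

/-! ### The scalarized constraint and its supremum function. -/

section SupremumFunction

variable {H Y : Type*} [NormedAddCommGroup Y] [NormedSpace ℝ Y] {m : ℕ}

/-- Membership in a closed convex cone is tested on a generator of its positive dual cone. -/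
theorem neg_mem_iff_forall_generator_le {K : ProperCone ℝ Y} {C : Set (WeakDual ℝ Y)}
    (hgen : closure (genCone C) = posDual (K : Set Y)) (y : Y) :
    -y ∈ (K : Set Y) ↔ ∀ v ∈ C, v y ≤ 0 := by
  constructor
  · intro hy v hv
    have hvK : v ∈ posDual (K : Set Y) :=
      hgen ▸ subset_closure ⟨1, zero_le_one, v, hv, (one_smul ℝ v).symm⟩
    have := hvK _ hy
    rw [map_neg] at this
    linarith
  · intro h
    by_contra hy
    obtain ⟨f, hf, hfy⟩ := K.hyperplane_separation_point hy
    have hfK : StrongDual.toWeakDual f ∈ closure (genCone C) := by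
      rw [hgen]
      exact fun z hz => hf z hz
    -- This weak-* closed half-space contains the generated cone, hence also the separating
    -- functional `f`, contradicting `f (-y) < 0`.
    have hcl : IsClosed {v : WeakDual ℝ Y | v y ≤ 0} :=
      isClosed_Iic.preimage (WeakDual.eval_continuous y)
    have hsub : genCone C ⊆ {v : WeakDual ℝ Y | v y ≤ 0} := by
      rintro _ ⟨t, ht, v, hv, rfl⟩
      exact mul_nonpos_of_nonneg_of_nonpos ht (h v hv)
    have h1 : f y ≤ 0 := closure_minimal hsub hcl hfK
    rw [map_neg] at hfy
    linarith

variable {Φ : H × EuclideanSpace ℝ (Fin m) → Y} {h : H → ℝ} {C : Set (WeakDual ℝ Y)}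

theorem supFun_le_iff {q : WithLp 2 (H × EuclideanSpace ℝ (Fin m))} {t : ℝ} :
    supFun Φ h C q ≤ t ↔ ∀ v ∈ C, v (Φ (q.fst, q.snd)) + h q.fst ≤ t := by
  simp only [supFun, iSup₂_le_iff, EReal.coe_le_coe_iff]

/-- The summand `h x` cancels. It is there only to make the scalarizations convex. -/
theorem supFun_le_iff_neg_mem {K : ProperCone ℝ Y}
    (hgen : closure (genCone C) = posDual (K : Set Y)) (x : H) (z : EuclideanSpace ℝ (Fin m)) :
    supFun Φ h C (WithLp.toLp 2 (x, z)) ≤ h x ↔ -Φ (x, z) ∈ (K : Set Y) := by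
  rw [supFun_le_iff, neg_mem_iff_forall_generator_le hgen]
  simp

theorem supFun_ne_bot (hC : C.Nonempty) (q : WithLp 2 (H × EuclideanSpace ℝ (Fin m))) :
    supFun Φ h C q ≠ ⊥ := by
  obtain ⟨v, hv⟩ := hC
  refine ne_bot_of_le_ne_bot (EReal.coe_ne_bot _) (le_iSup₂ (f := fun (v : WeakDual ℝ Y)
    (_ : v ∈ C) => ((v (Φ (q.fst, q.snd)) + h q.fst : ℝ) : EReal)) v hv)

/-- Weak-* compactness bounds the evaluations on `C`. Finiteness of `S` then makes its envelope an
infimum of continuous functions, which yields measurability of the events. -/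
theorem supFun_ne_top (hC : IsCompact C) (q : WithLp 2 (H × EuclideanSpace ℝ (Fin m))) :
    supFun Φ h C q ≠ ⊤ := by
  obtain ⟨M, hM⟩ := (hC.image (WeakDual.eval_continuous (Φ (q.fst, q.snd)))).bddAbove
  have : supFun Φ h C q ≤ ((M + h q.fst : ℝ) : EReal) :=
    supFun_le_iff.2 fun v hv => by
      have : v (Φ (q.fst, q.snd)) ≤ M := hM ⟨v, hv, rfl⟩
      linarith
  exact (this.trans_lt (EReal.coe_lt_top _)).ne

variable [NormedAddCommGroup H]

theorem lowerSemicontinuous_supFun (hΦ : Continuous Φ) (hh : Continuous h) :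
    LowerSemicontinuous (supFun Φ h C) := by
  refine lowerSemicontinuous_biSup fun v _ => Continuous.lowerSemicontinuous ?_
  have hpair : Continuous fun q : WithLp 2 (H × EuclideanSpace ℝ (Fin m)) => (q.fst, q.snd) :=
    WithLp.prod_continuous_ofLp 2 _ _
  exact continuous_coe_real_ereal.comp
    ((v.continuous.comp (hΦ.comp hpair)).add (hh.comp (continuous_fst.comp hpair)))

theorem isConvexFun_supFun [InnerProductSpace ℝ H] (hconv : ∀ v ∈ C,
    ConvexOn ℝ univ (fun q : H × EuclideanSpace ℝ (Fin m) => v (Φ q) + h q.1)) :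
    IsConvexFun (supFun Φ h C) := by
  rintro ⟨q, s⟩ hq ⟨r, t⟩ hr a b ha hb hab
  refine supFun_le_iff.2 fun v hv => ?_
  have h1 := (hconv v hv).2 (mem_univ (q.fst, q.snd)) (mem_univ (r.fst, r.snd)) ha hb hab
  have h2 := mul_le_mul_of_nonneg_left (supFun_le_iff.1 hq v hv) ha
  have h3 := mul_le_mul_of_nonneg_left (supFun_le_iff.1 hr v hv) hb
  simp only [smul_eq_mul, Prod.smul_mk, Prod.mk_add_mk] at h1
  simp only [Prod.smul_mk, Prod.mk_add_mk, WithLp.add_fst, WithLp.add_snd, WithLp.smul_fst,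
    WithLp.smul_snd, smul_eq_mul]
  linarith

/-- The Moreau envelope of a finite function is upper semicontinuous. -/
theorem upperSemicontinuous_moreauEnv {E : Type*} [NormedAddCommGroup E] {f : E → EReal}
    (hbot : ∀ x, f x ≠ ⊥) (htop : ∀ x, f x ≠ ⊤) (lam : ℝ) :
    UpperSemicontinuous (moreauEnv f lam) := by
  refine upperSemicontinuous_iInf fun z => Continuous.upperSemicontinuous ?_
  rw [← EReal.coe_toReal (htop z) (hbot z)]
  simp_rw [← EReal.coe_add]
  exact continuous_coe_real_ereal.comp (by fun_prop)

theorem weaklyTendsto_toLp [InnerProductSpace ℝ H] {x : ℕ → H} {x₀ : H} (hx : WeaklyTendsto x x₀)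
    (z : EuclideanSpace ℝ (Fin m)) :
    WeaklyTendsto (fun k => WithLp.toLp 2 (x k, z)) (WithLp.toLp 2 (x₀, z)) := by
  intro y
  simp only [WithLp.prod_inner_apply]
  exact (hx y.fst).add tendsto_const_nhds

end SupremumFunction

/-! ### Stability of the probabilistic feasible sets. -/

section FeasibleSets

variable {H Y Ω : Type*} [NormedAddCommGroup H] [NormedAddCommGroup Y] [NormedSpace ℝ Y]
  [MeasurableSpace Ω] {P : Measure Ω} [IsProbabilityMeasure P] {m : ℕ} {ξ : Ω → EuclideanSpace ℝ (Fin m)}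
  {Φ : H × EuclideanSpace ℝ (Fin m) → Y} {h : H → ℝ} {C : Set (WeakDual ℝ Y)}
  {K : ProperCone ℝ Y} {p : ℝ}

/-- The event defining the regularized probability function is measurable. -/
theorem measurableSet_moreauEnv_supFun_le (hξ : Measurable ξ) (hne : C.Nonempty)
    (hC : IsCompact C) (lam : ℝ) (x : H) :
    MeasurableSet {ω | moreauEnv (supFun Φ h C) lam (WithLp.toLp 2 (x, ξ ω)) ≤ (h x : EReal)} := by
  have h1 : UpperSemicontinuous fun z : EuclideanSpace ℝ (Fin m) =>
      moreauEnv (supFun Φ h C) lam (WithLp.toLp 2 (x, z)) :=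
    (upperSemicontinuous_moreauEnv (supFun_ne_bot hne) (supFun_ne_top hC) lam).comp
      ((WithLp.prod_continuous_toLp 2 _ _).comp (by fun_prop))
  exact hξ (h1.measurable measurableSet_Iic)

theorem feas_subset_feasReg (hgen : closure (genCone C) = posDual (K : Set Y)) (lam : ℝ) :
    feas P ξ Φ (K : Set Y) p ⊆ feasReg P ξ Φ h C p lam := by
  intro x hx
  refine le_trans hx (measureReal_mono fun ω hω => ?_)
  exact (moreauEnv_le _ _ _).trans ((supFun_le_iff_neg_mem hgen x (ξ ω)).2 hω)

/-- Weak limits of points feasible for the regularized constraints with vanishing parameters are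
feasible. -/
theorem mem_feas_of_weaklyTendsto [InnerProductSpace ℝ H] [CompleteSpace H] (hξ : Measurable ξ)
    (hne : C.Nonempty) (hC : IsCompact C) (hgen : closure (genCone C) = posDual (K : Set Y)) (hΦ : Continuous Φ)
    (hh : Continuous h) (hconv : ∀ v ∈ C,
      ConvexOn ℝ univ (fun q : H × EuclideanSpace ℝ (Fin m) => v (Φ q) + h q.1))
    (hw : SeqWeaklyContinuous h) {lam : ℕ → ℝ} {x : ℕ → H} {x₀ : H} (hlam : ∀ k, 0 < lam k)
    (hlim : Tendsto lam atTop (𝓝 0)) (hx : WeaklyTendsto x x₀)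
    (hmem : ∀ k, x k ∈ feasReg P ξ Φ h C p (lam k)) : x₀ ∈ feas P ξ Φ (K : Set Y) p := by
  set A : ℕ → Set Ω := fun k =>
    {ω | moreauEnv (supFun Φ h C) (lam k) (WithLp.toLp 2 (x k, ξ ω)) ≤ (h (x k) : EReal)} with hA
  have hAm : ∀ k, MeasurableSet (A k) := fun k =>
    measurableSet_moreauEnv_supFun_le hξ hne hC (lam k) (x k)
  -- The decreasing tail unions intersect in the limsup of the events, whose probability is still at
  -- least `p` by continuity from above.
  set B : ℕ → Set Ω := fun n => ⋃ k ≥ n, A k with hB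
  have hBanti : Antitone B := fun i j hij =>
    biUnion_subset_biUnion_left fun k (hk : j ≤ k) => hij.trans hk
  have hBlim : Tendsto (fun n => P.real (B n)) atTop (𝓝 (P.real (⋂ n, B n))) := by
    have h1 := tendsto_measure_iInter_atTop (μ := P) (s := B)
      (fun n => (MeasurableSet.iUnion fun k => .iUnion fun _ => hAm k).nullMeasurableSet) hBanti
      ⟨0, measure_ne_top P _⟩
    exact (ENNReal.tendsto_toReal (measure_ne_top P _)).comp h1
  have hp : p ≤ P.real (⋂ n, B n) := ge_of_tendsto' hBlim fun n =>
    (hmem n).trans (measureReal_mono (subset_biUnion_of_mem (u := A) (le_refl n))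
      (measure_ne_top P _))
  refine hp.trans (measureReal_mono fun ω hω => ?_)
  have hfreq : ∃ᶠ k in atTop, ω ∈ A k := by
    rw [frequently_atTop]
    intro n
    simpa [hB] using mem_iInter.1 hω n
  obtain ⟨φ, hφ, hφA⟩ := extraction_of_frequently_atTop hfreq
  -- The subsequence depends on `ω`. Weak continuity of `h` makes the right-hand sides converge to
  -- `h x₀`.
  obtain ⟨-, -, -, -, -, -, hle⟩ := (isConvexFun_supFun hconv).exists_seq_of_moreauEnv_le
    (lowerSemicontinuous_supFun hΦ hh) (supFun_ne_bot hne) (fun k => hlam (φ k))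
    (hlim.comp hφ.tendsto_atTop) (weaklyTendsto_toLp (hx.comp_tendsto hφ.tendsto_atTop) (ξ ω))
    ((hw _ _ hx).comp hφ.tendsto_atTop) hφA
  exact (supFun_le_iff_neg_mem hgen x₀ (ξ ω)).1 hle

end FeasibleSets

/-! ### From weak to norm convergence. -/

section StrongConvergence

variable {E : Type*} [NormedAddCommGroup E] [InnerProductSpace ℝ E] [CompleteSpace E]

/-- Let `f` be a finite convex lower semicontinuous function whose conjugate is Fréchet
differentiable wherever it is subdifferentiable. If `w k ⇀ x₀` weakly and
`limsup f (w k) ≤ f x₀`, then `w k → x₀` in norm. -/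
theorem IsConvexFun.tendsto_of_weaklyTendsto {f : E → EReal} (hf : IsConvexFun f)
    (hlsc : LowerSemicontinuous f) (hbot : ∀ x, f x ≠ ⊥) (hdom : effDom f = univ)
    (hdiff : ∀ u : E, (subdiff (conjugate f) u).Nonempty → FrechetDiffAt (conjugate f) u)
    {w : ℕ → E} {x₀ : E} {d : ℕ → ℝ} (hw : WeaklyTendsto w x₀) (hd : ∀ k, f (w k) ≤ d k)
    (hdlim : Tendsto (fun k => (d k : EReal)) atTop (𝓝 (f x₀))) : Tendsto w atTop (𝓝 x₀) := by
  have htop : ∀ x, f x ≠ ⊤ := fun x => (show x ∈ effDom f from hdom ▸ mem_univ x).ne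
  set g : E → ℝ := fun x => (f x).toReal with hg
  have hfg : ∀ x, f x = g x := fun x => (EReal.coe_toReal (htop x) (hbot x)).symm
  have hgconv : ConvexOn ℝ univ g := by
    rw [convexOn_iff_convex_epigraph]
    have : {p : E × ℝ | p.1 ∈ univ ∧ g p.1 ≤ p.2} = {q : E × ℝ | f q.1 ≤ (q.2 : EReal)} := by
      ext q
      simp [hfg]
    rw [this]
    exact hf
  have hglsc : LowerSemicontinuous g := by
    rw [lowerSemicontinuous_iff_isClosed_preimage]
    intro t
    have : g ⁻¹' Iic t = f ⁻¹' Iic (t : EReal) := by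
      ext q
      simp [hfg]
    rw [this]
    exact hlsc.isClosed_preimage _
  obtain ⟨u, hu⟩ := hgconv.exists_subgradient hglsc x₀
  have hconj : conjugate f u = ((⟪u, x₀⟫_ℝ - g x₀ : ℝ) : EReal) := by
    refine le_antisymm (iSup_le fun y => ?_) ?_
    · rw [hfg, ← EReal.coe_sub, EReal.coe_le_coe_iff]
      have := hu y
      rw [inner_sub_right] at this
      linarith
    · refine le_trans (le_of_eq ?_)
        (le_iSup (fun y : E => ((⟪u, y⟫_ℝ : ℝ) : EReal) - f y) x₀)
      simp only [hfg, EReal.coe_sub]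
  -- The Fenchel equality places `x₀` in the subdifferential of the conjugate, which activates the
  -- differentiability hypothesis at `u`.
  have hsub : x₀ ∈ subdiff (conjugate f) u := by
    refine ⟨hconj ▸ EReal.coe_lt_top _, fun y => ?_⟩
    refine le_trans (le_of_eq ?_) (le_iSup (fun z : E => ((⟪y, z⟫_ℝ : ℝ) : EReal) - f z) x₀)
    simp only [hfg, hconj, ← EReal.coe_sub, ← EReal.coe_add]
    rw [inner_sub_right, real_inner_comm y x₀, real_inner_comm u x₀]
    congr 1
    ring
  obtain ⟨D, hD⟩ := exists_gradient_of_frechetDiffAt_conjugate (hdiff u ⟨x₀, hsub⟩)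
  have hreal : (conjugate f u).toReal = ⟪u, x₀⟫_ℝ - g x₀ := by rw [hconj, EReal.toReal_coe]
  rw [hreal] at hD
  -- The constant sequence `x₀` is minimizing with zero error, so the gradient must be `x₀`.
  have hDx : D = x₀ := tendsto_nhds_unique
    (hD (fun _ => x₀) (fun _ => 0) tendsto_const_nhds fun k => by
      rw [hfg, EReal.coe_le_coe_iff]
      linarith) tendsto_const_nhds
  have hdg : Tendsto d atTop (𝓝 (g x₀)) := by
    rw [hfg] at hdlim
    exact_mod_cast hdlim
  rw [← hDx]
  refine hD w (fun k => (d k - g x₀) - (⟪u, w k⟫_ℝ - ⟪u, x₀⟫_ℝ)) ?_ fun k => ?_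
  · simpa using (hdg.sub_const (g x₀)).sub ((hw u).sub_const ⟪u, x₀⟫_ℝ)
  · refine (hd k).trans ?_
    rw [EReal.coe_le_coe_iff]
    linarith

end StrongConvergence

end ChanceConstraint

/-! ### Values and optimal solutions of the regularized problems. -/

open ChanceConstraint in
theorem mainTheorem5
    {H Y Ω : Type*}
    [NormedAddCommGroup H] [InnerProductSpace ℝ H] [CompleteSpace H]
    [TopologicalSpace.SeparableSpace H]
    [NormedAddCommGroup Y] [NormedSpace ℝ Y] [CompleteSpace Y]
    [MeasurableSpace Ω] (P : Measure Ω) [IsProbabilityMeasure P]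
    {m : ℕ} (ξ : Ω → EuclideanSpace ℝ (Fin m)) (hξ : Measurable ξ)
    (hξ_density : HasPDF ξ P volume)
    -- the closed convex cone, and a weak-* compact convex generator of its positive dual cone
    (K : ProperCone ℝ Y)
    (C : Set (WeakDual ℝ Y)) (hC_ne : C.Nonempty) (hC_compact : IsCompact C)
    (hC_convex : Convex ℝ C) (hC_gen : closure (genCone C) = posDual (K : Set Y))
    -- the constraint function and the convexity of its scalarizations up to `h`
    (Φ : H × EuclideanSpace ℝ (Fin m) → Y) (hΦ : Continuous Φ)
    (h : H → ℝ) (hh_smooth : ContDiff ℝ 1 h) (hh_convex : ConvexOn ℝ univ h)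
    (hΦ_convex : ∀ v ∈ C,
      ConvexOn ℝ univ (fun q : H × EuclideanSpace ℝ (Fin m) => v (Φ q) + h q.1))
    (p : ℝ) (hp : p ∈ Icc (0 : ℝ) 1)
    -- the objective function, with values in `ℝ ∪ {+∞}`
    (ψ : H → EReal) (hψ_bot : ∀ x, ψ x ≠ ⊥) (hψ_convex : IsConvexFun ψ)
    (hψ_coercive : IsCoercive ψ) (hψ_lsc : LowerSemicontinuous ψ)
    (hfeas : (feas P ξ Φ (K : Set Y) p ∩ effDom ψ).Nonempty) :
    (∃ r : ℝ, value ψ (feas P ξ Φ (K : Set Y) p) = (r : EReal)) ∧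
    (∀ lam : ℝ, 0 < lam →
      ∃ r : ℝ, value (moreauEnv ψ lam) (feasReg P ξ Φ h C p lam) = (r : EReal)) ∧
    (SeqWeaklyContinuous h →
      Tendsto (fun lam : ℝ => value (moreauEnv ψ lam) (feasReg P ξ Φ h C p lam))
        (𝓝[>] 0) (𝓝 (value ψ (feas P ξ Φ (K : Set Y) p))) ∧
      ∀ (lam : ℕ → ℝ) (x : ℕ → H) (x₀ : H),
        (∀ k, 0 < lam k) → Tendsto lam atTop (𝓝 0) →
        (∀ k, IsOptimal (moreauEnv ψ (lam k)) (feasReg P ξ Φ h C p (lam k)) (x k)) →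
        WeaklyTendsto x x₀ →
        IsOptimal ψ (feas P ξ Φ (K : Set Y) p) x₀ ∧
        (effDom ψ = univ →
          (∀ u : H, (subdiff (conjugate ψ) u).Nonempty → FrechetDiffAt (conjugate ψ) u) →
          Tendsto x atTop (𝓝 x₀))) := by
  obtain ⟨xf, hxf, hxfd⟩ := hfeas
  obtain ⟨a, ha⟩ := hψ_convex.exists_forall_le hψ_lsc hψ_bot hψ_coercive
  have hreal : ∀ {v : EReal}, (a : EReal) ≤ v → v ≤ ψ xf → ∃ r : ℝ, v = r := fun h₁ h₂ =>
    ⟨_, (EReal.coe_toReal (h₂.trans_lt hxfd).ne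
      (ne_bot_of_le_ne_bot (EReal.coe_ne_bot a) h₁)).symm⟩
  have hsub := fun lam : ℝ =>
    feas_subset_feasReg (P := P) (ξ := ξ) (Φ := Φ) (h := h) (p := p) hC_gen lam
  have hval_le : ∀ lam, value (moreauEnv ψ lam) (feasReg P ξ Φ h C p lam) ≤
      value ψ (feas P ξ Φ (K : Set Y) p) := fun lam =>
    le_iInf₂ fun x hx => (iInf₂_le x (hsub lam hx)).trans (moreauEnv_le _ _ _)
  have hval_xf : value ψ (feas P ξ Φ (K : Set Y) p) ≤ ψ xf := iInf₂_le xf hxf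
  obtain ⟨r, hr⟩ := hreal (le_iInf₂ fun x _ => ha x) hval_xf
  refine ⟨⟨r, hr⟩, fun lam hlam => hreal (le_iInf₂ fun x _ => le_moreauEnv ha hlam x)
    ((hval_le lam).trans hval_xf), fun hw => ⟨?_, ?_⟩⟩
  · refine tendsto_order.2 ⟨fun c hc => ?_, fun c hc =>
      Eventually.of_forall fun lam => (hval_le lam).trans_lt hc⟩
    by_contra hcon
    obtain ⟨c', hcc', hc'⟩ := EReal.lt_iff_exists_real_btwn.1 hc
    have hfreq : ∃ᶠ lam in 𝓝[>] (0 : ℝ),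
        value (moreauEnv ψ lam) (feasReg P ξ Φ h C p lam) < c' ∧ 0 < lam := by
      refine ((not_eventually.1 hcon).mono fun lam hl => ?_).and_eventually self_mem_nhdsWithin
      exact (not_lt.1 hl).trans_lt hcc'
    obtain ⟨lam, hlim, hlam⟩ := exists_seq_forall_of_frequently hfreq
    have hlim0 : Tendsto lam atTop (𝓝 0) := hlim.mono_right nhdsWithin_le_nhds
    have hex : ∀ k, ∃ x ∈ feasReg P ξ Φ h C p (lam k), moreauEnv ψ (lam k) x < c' := fun k => by
      simpa [value, iInf_lt_iff] using (hlam k).1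
    choose x hxmem hxlt using hex
    -- The constant minorant `a` allows slope `b = 0`, so no bound on the points `x k` is needed;
    -- boundedness of `w` comes from coercivity instead.
    obtain ⟨w, hwle, hxw⟩ := exists_seq_of_moreauEnv_lt hψ_bot (a := a) (b := 0) le_rfl
      (by simpa using ha) (c := fun _ => c') (R := 0) (M := c') (fun k => (hlam k).2) hlim0
      (by simp) (fun _ => le_rfl) hxlt
    obtain ⟨R, hR⟩ := (hψ_coercive c').exists_norm_le
    obtain ⟨x₀, φ, hφ, hwx₀⟩ := exists_subseq_weaklyTendsto fun k => hR (w k) (hwle k)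
    have hψx₀ : ψ x₀ ≤ c' := hwx₀.le_of_forall_le hψ_convex hψ_lsc tendsto_const_nhds
      fun k => hwle (φ k)
    have hxx₀ : WeaklyTendsto (fun k => x (φ k)) x₀ := hwx₀.of_norm_sub_tendsto_zero <| by
      simpa [Function.comp_def, norm_sub_rev] using hxw.comp hφ.tendsto_atTop
    have hx₀ : x₀ ∈ feas P ξ Φ (K : Set Y) p :=
      mem_feas_of_weaklyTendsto hξ hC_ne hC_compact hC_gen hΦ hh_smooth.continuous hΦ_convex hw
        (fun k => (hlam (φ k)).2) (hlim0.comp hφ.tendsto_atTop) hxx₀ fun k => hxmem (φ k)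
    exact ((iInf₂_le x₀ hx₀).trans hψx₀).not_gt hc'
  · intro lam x x₀ hlam hlim hopt hx
    have hx₀ : x₀ ∈ feas P ξ Φ (K : Set Y) p :=
      mem_feas_of_weaklyTendsto hξ hC_ne hC_compact hC_gen hΦ hh_smooth.continuous hΦ_convex hw
        hlam hlim hx fun k => (hopt k).1
    have henv : ∀ k, moreauEnv ψ (lam k) (x k) ≤ r := fun k =>
      (le_iInf₂ fun y hy => (hopt k).2 hy).trans ((hval_le (lam k)).trans hr.le)
    obtain ⟨w, d, hwd, hd, hxw, hwx₀, hψx₀⟩ := hψ_convex.exists_seq_of_moreauEnv_le hψ_lsc hψ_bot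
      hlam hlim hx tendsto_const_nhds henv
    refine ⟨⟨hx₀, fun y hy => hψx₀.trans (hr ▸ iInf₂_le y hy)⟩, fun hdom hdiff => ?_⟩
    -- Feasibility of `x₀` turns the upper bound into equality, so the bounds `d k` on `ψ (w k)`
    -- tend to `ψ x₀`, as norm convergence requires.
    have hψr : ψ x₀ = r := hψx₀.antisymm (hr ▸ iInf₂_le x₀ hx₀)
    have hwlim := hψ_convex.tendsto_of_weaklyTendsto hψ_lsc hψ_bot hdom hdiff hwx₀ hwd
      (hψr ▸ (continuous_coe_real_ereal.tendsto r).comp hd)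
    simpa using hwlim.add (tendsto_zero_iff_norm_tendsto_zero.2 hxw)
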